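/- Let $x_0\in\mathbb C^n$ with $\|x_0\|=1$, let $\alpha>0$, and let $a_i^1,a_i^2$ ($i=1,\dots,m$) be $2m$ independent random vectors in $\mathbb C^n$ with law $\mathcal N(0,\tfrac12 I_n)+i\,\mathcal N(0,\tfrac12 I_n)$ (independent real and imaginary parts). Put $\theta(z)=\tanh(\alpha z)$, $$y_i=\operatorname{sign}\bigl(\theta(|\langle a_i^1,x_0\rangle|^2)-\theta(|\langle a_i^2,x_0\rangle|^2)\bigr),\qquad \hat C_m=\frac1m\sum_{i=1}^m y_i\,(a_i^1a_i^{1,*}-a_i^2a_i^{2,*}),$$ and let $\hat x_m$ be a solution of $\max_{\|x\|=1}x^*\hat C_m x$. Let $$\lambda(\alpha)=\mathbb E\bigl(|E_1-E_2|\,\operatorname{sign}(1-\tanh(\alpha E_1)\tanh(\alpha E_2))\bigr),\qquad E_1,E_2\ \text{i.i.d.}\sim \mathrm{Exp}(1).$$ 1. There are absolute constants $C,K>0$ such that for all $n$, $m$, $x_0$ and $\alpha$ as above and every $\epsilon\in(0,1]$ with $$m\ge \frac{C}{\epsilon^2}\,\frac{n\log n}{\lambda(\alpha)},$$ with probability at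 least $1-K n^{-2}$ the following holds: for every such solution $\hat x_m$ there is a global phase $\phi\in[0,2\pi]$ with $\|\hat x_m-e^{i\phi}x_0\|^2\le\epsilon$. 2. For every $\alpha>0$ the expectation defining $\lambda(\alpha)$ is finite and positive, and $\lambda$ is a decreasing function of $\alpha$ on $(0,\infty)$ in the weak sense: $\lambda(\beta)\le\lambda(\alpha)$ whenever $0<\alpha\le\beta$. -/

import Mathlib

open MeasureTheory ProbabilityTheory
open scoped Matrix

noncomputable section

namespace OneBit

/-- The law of `X + i Y` with `X`, `Y` independent real Gaussians of mean `0` and variance `1/2`. -/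
def complexGaussian : Measure ℂ :=
  ((gaussianReal 0 (1 / 2)).prod (gaussianReal 0 (1 / 2))).map
    (fun p : ℝ × ℝ => (p.1 : ℂ) + (p.2 : ℂ) * Complex.I)

/-- The law `N(0, I/2) + i N(0, I/2)` on `ℂⁿ`: the coordinates are i.i.d. complex Gaussians. -/
def complexGaussianVec (n : ℕ) : Measure (EuclideanSpace ℂ (Fin n)) :=
  (Measure.pi (fun _ : Fin n => complexGaussian)).map (fun v => WithLp.toLp 2 v)

/-- The phase-less measurement (intensity) `|⟨a, x⟩|²`. -/
def intensity {n : ℕ} (a x : EuclideanSpace ℂ (Fin n)) : ℝ := ‖inner ℂ a x‖ ^ 2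

/-- One-bit quantizer of a pair of distorted intensities:
`sign (θ(|⟨a¹, x₀⟩|²) - θ(|⟨a², x₀⟩|²))`. -/
def quantizer {n : ℕ} (θ : ℝ → ℝ) (x₀ a₁ a₂ : EuclideanSpace ℂ (Fin n)) : ℝ :=
  Real.sign (θ (intensity a₁ x₀) - θ (intensity a₂ x₀))

/-- The rank one matrix `a a*`. -/
def outer {n : ℕ} (a : EuclideanSpace ℂ (Fin n)) : Matrix (Fin n) (Fin n) ℂ :=
  Matrix.vecMulVec a.ofLp (star a.ofLp)

/-- The matrix `(1/m) ∑ᵢ yᵢ (a¹ᵢ a¹ᵢ* - a²ᵢ a²ᵢ*)`, where `yᵢ` is the one-bit measurement of `x₀`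
by the `i`-th pair `(a i 0, a i 1)` of sensing vectors. -/
def empMatrix {n m : ℕ} (θ : ℝ → ℝ) (x₀ : EuclideanSpace ℂ (Fin n))
    (a : Fin m → Fin 2 → EuclideanSpace ℂ (Fin n)) : Matrix (Fin n) (Fin n) ℂ :=
  (1 / (m : ℂ)) • ∑ i, (quantizer θ x₀ (a i 0) (a i 1) : ℂ) • (outer (a i 0) - outer (a i 1))

/-- The quadratic form `x* A x` (real for Hermitian `A`). -/
def quadForm {n : ℕ} (A : Matrix (Fin n) (Fin n) ℂ) (x : EuclideanSpace ℂ (Fin n)) : ℝ :=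
  (star x.ofLp ⬝ᵥ (A *ᵥ x.ofLp)).re

/-- `x` solves the maximum eigenvalue problem `max x* A x` subject to `‖x‖ = 1`. -/
def IsOneBitPhaseSolution {n : ℕ} (A : Matrix (Fin n) (Fin n) ℂ)
    (x : EuclideanSpace ℂ (Fin n)) : Prop :=
  ‖x‖ = 1 ∧ ∀ z : EuclideanSpace ℂ (Fin n), ‖z‖ = 1 → quadForm A z ≤ quadForm A x

/-- Clipping distortion `θ(z) = tanh (α z)`. -/
def clip (α : ℝ) (z : ℝ) : ℝ := Real.tanh (α * z)

/-- `|E₁ - E₂| sign (1 - tanh (α E₁) tanh (α E₂))` as a function of `(E₁, E₂)`. -/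
def clipIntegrand (α : ℝ) (p : ℝ × ℝ) : ℝ :=
  |p.1 - p.2| * Real.sign (1 - Real.tanh (α * p.1) * Real.tanh (α * p.2))

/-- The joint law of two independent `Exp(1)` random variables. -/
def expPair : Measure (ℝ × ℝ) := (expMeasure 1).prod (expMeasure 1)

/-- `λ(α) = 𝔼 (|E₁ - E₂| sign (1 - tanh (α E₁) tanh (α E₂)))`, `E₁, E₂` i.i.d. `Exp(1)`. -/
def clipSNR (α : ℝ) : ℝ := ∫ p, clipIntegrand α p ∂expPair

end OneBit

end

noncomputable section

namespace OneBit

/-! ### The clipping distortion disappears from both the bits and `clipSNR` -/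

section Clip

/-! Since `tanh` is strictly increasing with values in (-1, 1), clipping changes neither the order
of two intensities nor the sign in the integrand of `clipSNR`. So the measured bits do not depend on
α, and `clipSNR` is the positive constant 𝔼|E₁ - E₂|; monotonicity is trivial (`quantizer_clip`,
`clipSNR_eq`).

For recovery, the form x*Ĉₘx is an average of i.i.d. copies of `bitForm x₀ x`, with mean S|⟨x,
x₀⟩|², S = `gaussianSNR` (`integral_bitForm`). Unitary symmetries of the Gaussian law kill every
contribution except that of the component along x₀. If the average is within Sε/4 of its mean on the
whole sphere, comparing a maximizer x with x₀ gives |⟨x, x₀⟩|² ≥ 1 - ε/2, and aligning phases gives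
the claim.

Uniformity comes from a Chernoff bound at each point (`measureReal_abs_sum_bitForm_sub_ge_le`), a
union over (16n+1)^(2n) grid points, and a net argument for quadratic forms
(`abs_sum_intensity_le_of_net`). The grid size is what costs n log n. S and `clipSNR` need not be
identified with each other: both are positive absolute constants, absorbed in C. -/

lemma tanh_strictMono : StrictMono Real.tanh := by
  intro x y h
  rw [Real.tanh_eq_sinh_div_cosh, Real.tanh_eq_sinh_div_cosh,
    div_lt_div_iff₀ (Real.cosh_pos x) (Real.cosh_pos y)]
  have h1 : 0 < Real.sinh (y - x) := Real.sinh_pos_iff.2 (sub_pos.2 h)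
  rw [Real.sinh_sub] at h1
  linarith

lemma abs_tanh_lt_one (x : ℝ) : |Real.tanh x| < 1 := by
  rw [Real.tanh_eq_sinh_div_cosh, abs_div, abs_of_pos (Real.cosh_pos x),
    div_lt_one (Real.cosh_pos x)]
  refine abs_lt_of_sq_lt_sq ?_ (Real.cosh_pos x).le
  linarith [Real.cosh_sq x]

lemma clipIntegrand_eq (α : ℝ) (p : ℝ × ℝ) : clipIntegrand α p = |p.1 - p.2| := by
  have h : |Real.tanh (α * p.1) * Real.tanh (α * p.2)| < 1 := by
    rw [abs_mul]
    exact mul_lt_one_of_nonneg_of_lt_one_left (abs_nonneg _) (abs_tanh_lt_one _)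
      (abs_tanh_lt_one _).le
  rw [clipIntegrand, Real.sign_of_pos (by linarith [(abs_lt.1 h).2]), mul_one]

lemma sign_sub_of_strictMono {f : ℝ → ℝ} (hf : StrictMono f) (s t : ℝ) :
    Real.sign (f s - f t) = Real.sign (s - t) := by
  rcases lt_trichotomy s t with h | h | h
  · rw [Real.sign_of_neg (sub_neg.2 (hf h)), Real.sign_of_neg (sub_neg.2 h)]
  · simp [h]
  · rw [Real.sign_of_pos (sub_pos.2 (hf h)), Real.sign_of_pos (sub_pos.2 h)]

lemma clip_strictMono {α : ℝ} (hα : 0 < α) : StrictMono (clip α) :=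
  fun _ _ h => tanh_strictMono (mul_lt_mul_of_pos_left h hα)

lemma quantizer_clip {n : ℕ} {α : ℝ} (hα : 0 < α) (x₀ a₁ a₂ : EuclideanSpace ℂ (Fin n)) :
    quantizer (clip α) x₀ a₁ a₂ = Real.sign (intensity a₁ x₀ - intensity a₂ x₀) :=
  sign_sub_of_strictMono (clip_strictMono hα) _ _

instance : IsProbabilityMeasure (expMeasure 1) := isProbabilityMeasure_expMeasure one_pos

instance : IsProbabilityMeasure expPair := by unfold expPair; infer_instance

instance : NullSingletonClass (expMeasure 1) := by
  unfold expMeasure gammaMeasure; infer_instance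

lemma integrable_id_expMeasure : Integrable (fun x : ℝ => x) (expMeasure 1) := by
  change Integrable (fun x : ℝ => x) (volume.withDensity (exponentialPDF 1))
  have hm : Measurable (exponentialPDF 1) := (measurable_exponentialPDFReal 1).ennreal_ofReal
  rw [integrable_withDensity_iff_integrable_smul' hm
    (Filter.Eventually.of_forall fun _ => ENNReal.ofReal_lt_top)]
  have h : (fun x : ℝ => (exponentialPDF 1 x).toReal • x)
      = Set.indicator (Set.Ioi 0) (fun x : ℝ => Real.exp (-x) * x ^ ((2 : ℝ) - 1)) := by
    funext x
    rcases lt_trichotomy x 0 with hx | hx | hx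
    · simp [exponentialPDF_of_neg hx, hx.le]
    · simp [hx]
    · have h2 : (2 : ℝ) - 1 = 1 := by norm_num
      simp [exponentialPDF_of_nonneg hx.le, hx, (Real.exp_pos _).le, h2]
  rw [h, integrable_indicator_iff measurableSet_Ioi]
  exact Real.GammaIntegral_convergent two_pos

lemma integrable_abs_sub_prod {μ : Measure ℝ} [IsProbabilityMeasure μ]
    (h : Integrable (fun x : ℝ => x) μ) :
    Integrable (fun p : ℝ × ℝ => |p.1 - p.2|) (μ.prod μ) :=
  ((h.comp_fst μ).sub (h.comp_snd μ)).abs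

/-- The integrand vanishes only on the diagonal, which is null by Fubini when μ has no atoms. Serves
both `clipSNR` and `gaussianSNR`. -/
lemma integral_abs_sub_prod_pos {μ : Measure ℝ} [IsProbabilityMeasure μ] [NullSingletonClass μ]
    (h : Integrable (fun x : ℝ => x) μ) : 0 < ∫ p : ℝ × ℝ, |p.1 - p.2| ∂(μ.prod μ) := by
  rw [integral_pos_iff_support_of_nonneg (fun _ => abs_nonneg _) (integrable_abs_sub_prod h)]
  have hm : MeasurableSet {p : ℝ × ℝ | p.1 - p.2 = 0} :=
    measurableSet_eq_fun (by fun_prop) measurable_const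
  have hd : (μ.prod μ) {p : ℝ × ℝ | p.1 - p.2 = 0} = 0 := by
    rw [Measure.measure_prod_null hm]
    refine Filter.Eventually.of_forall fun x => ?_
    have : Prod.mk x ⁻¹' {p : ℝ × ℝ | p.1 - p.2 = 0} = {x} := by
      ext y; simp [sub_eq_zero, eq_comm]
    simp [this]
  have hs : Function.support (fun p : ℝ × ℝ => |p.1 - p.2|)
      = {p : ℝ × ℝ | p.1 - p.2 = 0}ᶜ := by
    ext p; simp
  rw [hs, measure_compl hm (measure_ne_top _ _), hd]
  simp

lemma clipSNR_eq (α : ℝ) : clipSNR α = ∫ p : ℝ × ℝ, |p.1 - p.2| ∂expPair := by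
  simp only [clipSNR, clipIntegrand_eq]

lemma integrable_clipIntegrand (α : ℝ) : Integrable (clipIntegrand α) expPair := by
  rw [show clipIntegrand α = fun p => |p.1 - p.2| from funext (clipIntegrand_eq α)]
  exact integrable_abs_sub_prod integrable_id_expMeasure

lemma clipSNR_pos (α : ℝ) : 0 < clipSNR α := by
  rw [clipSNR_eq]
  exact integral_abs_sub_prod_pos integrable_id_expMeasure

end Clip

/-! ### Characteristic functions and unitary symmetries of the complex Gaussian law -/

section Gaussian

instance : IsProbabilityMeasure complexGaussian :=
  Measure.isProbabilityMeasure_map (by fun_prop)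

instance (n : ℕ) : IsProbabilityMeasure (complexGaussianVec n) :=
  Measure.isProbabilityMeasure_map (by fun_prop)

lemma charFun_complexGaussian (t : ℂ) :
    charFun complexGaussian t = Complex.exp (-((‖t‖ ^ 2 / 4 : ℝ) : ℂ)) := by
  rw [charFun_apply, complexGaussian, integral_map (by fun_prop) (by fun_prop)]
  have h : ∀ p : ℝ × ℝ,
      Complex.exp ((inner ℝ ((p.1 : ℂ) + (p.2 : ℂ) * Complex.I) t : ℝ) * Complex.I)
      = Complex.exp (t.re * p.1 * Complex.I) * Complex.exp (t.im * p.2 * Complex.I) := by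
    intro p
    rw [← Complex.exp_add, Complex.inner]
    congr 1
    simp only [map_add, Complex.conj_ofReal, map_mul, Complex.conj_I, Complex.mul_re,
      Complex.add_re, Complex.ofReal_re, Complex.ofReal_im, Complex.neg_re, Complex.I_re,
      Complex.neg_im, Complex.I_im, Complex.add_im, Complex.mul_im]
    push_cast
    ring
  simp_rw [h]
  rw [integral_prod_mul (fun x : ℝ => Complex.exp (t.re * x * Complex.I))
    (fun y : ℝ => Complex.exp (t.im * y * Complex.I)), ← charFun_apply_real,
    ← charFun_apply_real, charFun_gaussianReal, charFun_gaussianReal, ← Complex.exp_add,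
    ← Complex.normSq_eq_norm_sq, Complex.normSq_apply]
  congr 1
  push_cast
  ring

lemma real_inner_eq_re {n : ℕ} (x y : EuclideanSpace ℂ (Fin n)) :
    (inner ℝ x y : ℝ) = (inner ℂ x y : ℂ).re := by
  simp only [PiLp.inner_apply, Complex.re_sum]
  rfl

lemma charFun_complexGaussianVec {n : ℕ} (t : EuclideanSpace ℂ (Fin n)) :
    charFun (complexGaussianVec n) t = Complex.exp (-((‖t‖ ^ 2 / 4 : ℝ) : ℂ)) := by
  have h := charFun_pi (E := fun _ : Fin n => ℂ) (μ := fun _ => complexGaussian) t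
  simp_rw [charFun_complexGaussian] at h
  rw [← Complex.exp_sum, Finset.sum_neg_distrib, ← Complex.ofReal_sum, ← Finset.sum_div,
    ← EuclideanSpace.norm_sq_eq] at h
  rw [← h, complexGaussianVec]

lemma map_inner_complexGaussianVec {n : ℕ} (x : EuclideanSpace ℂ (Fin n)) :
    (complexGaussianVec n).map (fun a => inner ℂ x a) = complexGaussian.map (fun z => ‖x‖ • z) := by
  have hm : Measurable (fun a : EuclideanSpace ℂ (Fin n) => inner ℂ x a) :=
    Continuous.measurable (by fun_prop)
  have := Measure.isProbabilityMeasure_map (μ := complexGaussianVec n) hm.aemeasurable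
  have h2 : Measurable (fun z : ℂ => ‖x‖ • z) := by fun_prop
  have := Measure.isProbabilityMeasure_map (μ := complexGaussian) h2.aemeasurable
  refine Measure.ext_of_charFun (funext fun t => ?_)
  rw [charFun_map_smul, charFun_complexGaussian, charFun_apply,
    integral_map hm.aemeasurable (by fun_prop)]
  have h : ∀ a : EuclideanSpace ℂ (Fin n),
      (inner ℝ (inner ℂ x a) t : ℝ) = inner ℝ a (t • x) := by
    intro a
    rw [real_inner_eq_re, inner_smul_right, Complex.inner, inner_conj_symm, mul_comm]
  simp_rw [h]
  rw [← charFun_apply, charFun_complexGaussianVec, norm_smul, norm_smul, norm_norm, mul_comm ‖t‖]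

/-- The characteristic function depends only on the norm of its argument, which an isometry
preserves. -/
lemma measurePreserving_linearIsometryEquiv {n : ℕ}
    (U : EuclideanSpace ℂ (Fin n) ≃ₗᵢ[ℂ] EuclideanSpace ℂ (Fin n)) :
    MeasurePreserving U (complexGaussianVec n) (complexGaussianVec n) := by
  have hm : Measurable U := U.continuous.measurable
  refine ⟨hm, ?_⟩
  have := Measure.isProbabilityMeasure_map (μ := complexGaussianVec n) hm.aemeasurable
  refine Measure.ext_of_charFun (funext fun t => ?_)
  rw [charFun_apply, integral_map hm.aemeasurable (by fun_prop)]
  have h : ∀ a, (inner ℝ (U a) t : ℝ) = inner ℝ a (U.symm t) := by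
    intro a
    rw [real_inner_eq_re, real_inner_eq_re, ← U.inner_map_map a, U.apply_symm_apply]
  simp_rw [h]
  rw [← charFun_apply, charFun_complexGaussianVec, charFun_complexGaussianVec, U.symm.norm_map]

variable {n : ℕ}

/-- Exchanges the components of the two vectors of a pair that are orthogonal to `K`. -/
def swapOrthogonal (K : Submodule ℂ (EuclideanSpace ℂ (Fin n)))
    (p : EuclideanSpace ℂ (Fin n) × EuclideanSpace ℂ (Fin n)) :
    EuclideanSpace ℂ (Fin n) × EuclideanSpace ℂ (Fin n) :=
  (p.2 + K.starProjection (p.1 - p.2), p.1 - K.starProjection (p.1 - p.2))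

/-- Self-adjointness on the product space; with involutivity it makes `swapOrthogonal K` unitary,
hence a symmetry of the Gaussian pair. -/
lemma inner_swapOrthogonal (K : Submodule ℂ (EuclideanSpace ℂ (Fin n)))
    (p t : EuclideanSpace ℂ (Fin n) × EuclideanSpace ℂ (Fin n)) :
    (inner ℂ (swapOrthogonal K p).1 t.1 + inner ℂ (swapOrthogonal K p).2 t.2 : ℂ)
      = inner ℂ p.1 (swapOrthogonal K t).1 + inner ℂ p.2 (swapOrthogonal K t).2 := by
  have h : ∀ u v, (inner ℂ (K.starProjection u) v : ℂ) = inner ℂ u (K.starProjection v) :=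
    fun u v => K.inner_starProjection_left_eq_right u v
  simp only [swapOrthogonal, inner_add_left, inner_add_right, inner_sub_left, inner_sub_right,
    map_sub, h]
  ring

lemma swapOrthogonal_swapOrthogonal (K : Submodule ℂ (EuclideanSpace ℂ (Fin n)))
    (p : EuclideanSpace ℂ (Fin n) × EuclideanSpace ℂ (Fin n)) :
    swapOrthogonal K (swapOrthogonal K p) = p := by
  have h : ∀ u, K.starProjection (K.starProjection u) = K.starProjection u := fun u =>
    K.starProjection_eq_self_iff.2 (K.starProjection_apply_mem u)
  ext1
  · simp only [swapOrthogonal, map_add, map_sub, h]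
    abel
  · simp only [swapOrthogonal, map_add, map_sub, h]
    abel

lemma norm_sq_swapOrthogonal (K : Submodule ℂ (EuclideanSpace ℂ (Fin n)))
    (p : EuclideanSpace ℂ (Fin n) × EuclideanSpace ℂ (Fin n)) :
    ‖(swapOrthogonal K p).1‖ ^ 2 + ‖(swapOrthogonal K p).2‖ ^ 2 = ‖p.1‖ ^ 2 + ‖p.2‖ ^ 2 := by
  have h := congrArg Complex.re (inner_swapOrthogonal K p (swapOrthogonal K p))
  rw [swapOrthogonal_swapOrthogonal] at h
  simpa only [inner_self_eq_norm_sq_to_K, Complex.add_re, Complex.coe_algebraMap,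
    ← Complex.ofReal_pow, Complex.ofReal_re] using h

lemma continuous_swapOrthogonal (K : Submodule ℂ (EuclideanSpace ℂ (Fin n))) :
    Continuous (swapOrthogonal K) := by
  unfold swapOrthogonal; fun_prop

lemma measurePreserving_swapOrthogonal (K : Submodule ℂ (EuclideanSpace ℂ (Fin n))) :
    MeasurePreserving (swapOrthogonal K) ((complexGaussianVec n).prod (complexGaussianVec n))
      ((complexGaussianVec n).prod (complexGaussianVec n)) := by
  have hm : Measurable (swapOrthogonal K) := (continuous_swapOrthogonal K).measurable
  refine ⟨hm, ?_⟩
  have := Measure.isProbabilityMeasure_map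
    (μ := (complexGaussianVec n).prod (complexGaussianVec n)) hm.aemeasurable
  refine charFun_eq_prod_iff.1 fun t => ?_
  rw [charFun_apply, integral_map (by fun_prop) (by fun_prop), integral_map (by fun_prop)
    (by fun_prop)]
  have h : ∀ p : EuclideanSpace ℂ (Fin n) × EuclideanSpace ℂ (Fin n),
      Complex.exp ((inner ℝ (WithLp.toLp 2 (swapOrthogonal K p)) t : ℝ) * Complex.I)
      = Complex.exp ((inner ℝ p.1 (swapOrthogonal K t.ofLp).1 : ℝ) * Complex.I)
        * Complex.exp ((inner ℝ p.2 (swapOrthogonal K t.ofLp).2 : ℝ) * Complex.I) := by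
    intro p
    rw [← Complex.exp_add, ← add_mul, ← Complex.ofReal_add, WithLp.prod_inner_apply]
    simp only [real_inner_eq_re, ← Complex.add_re]
    rw [← inner_swapOrthogonal]
  simp_rw [h]
  rw [integral_prod_mul (fun a : EuclideanSpace ℂ (Fin n) =>
      Complex.exp ((inner ℝ a (swapOrthogonal K t.ofLp).1 : ℝ) * Complex.I))
    (fun a : EuclideanSpace ℂ (Fin n) =>
      Complex.exp ((inner ℝ a (swapOrthogonal K t.ofLp).2 : ℝ) * Complex.I)),
    ← charFun_apply, ← charFun_apply]
  simp only [charFun_complexGaussianVec, ← Complex.exp_add]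
  congr 1
  have := norm_sq_swapOrthogonal K t.ofLp
  rw [← neg_add, ← neg_add, ← Complex.ofReal_add, ← Complex.ofReal_add]
  congr 2
  linarith

end Gaussian

/-! ### Exponential moments and the law of the intensities -/

section Moments

lemma integrable_exp_sq_gaussianReal :
    Integrable (fun x : ℝ => Real.exp (x ^ 2 / 2)) (gaussianReal 0 (1 / 2)) := by
  rw [gaussianReal_of_var_ne_zero _ (by norm_num), integrable_withDensity_iff_integrable_smul'
    (measurable_gaussianPDF _ _) (Filter.Eventually.of_forall fun _ => ENNReal.ofReal_lt_top)]
  have h : (fun x : ℝ => (gaussianPDF 0 (1 / 2) x).toReal • Real.exp (x ^ 2 / 2))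
      = fun x => (√(2 * Real.pi * ((1 / 2 : NNReal) : ℝ)))⁻¹ * Real.exp (-(1 / 2) * x ^ 2) := by
    funext x
    rw [toReal_gaussianPDF, gaussianPDFReal, smul_eq_mul, mul_assoc, ← Real.exp_add]
    congr 2
    push_cast
    ring
  rw [h]
  exact (integrable_exp_neg_mul_sq (by norm_num)).const_mul _

lemma integrable_exp_norm_sq :
    Integrable (fun z : ℂ => Real.exp (‖z‖ ^ 2 / 2)) complexGaussian := by
  rw [complexGaussian, integrable_map_measure (by fun_prop) (by fun_prop)]
  refine (integrable_exp_sq_gaussianReal.mul_prod integrable_exp_sq_gaussianReal).congr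
    (Filter.Eventually.of_forall fun p => ?_)
  simp only [Function.comp]
  rw [← Real.exp_add, ← Complex.normSq_eq_norm_sq, Complex.normSq_add_mul_I]
  congr 1
  ring

/-- The exponential moment `𝔼 exp (|g|² / 2)` of a complex Gaussian variable `g`. -/
def gaussianExpMoment : ℝ := ∫ z : ℂ, Real.exp (‖z‖ ^ 2 / 2) ∂complexGaussian

lemma one_le_gaussianExpMoment : 1 ≤ gaussianExpMoment := by
  have h : ∫ _ : ℂ, (1 : ℝ) ∂complexGaussian ≤ gaussianExpMoment :=
    integral_mono (integrable_const _) integrable_exp_norm_sq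
      fun z => Real.one_le_exp (by positivity)
  simpa using h

lemma integrable_norm_sq_complexGaussian :
    Integrable (fun z : ℂ => ‖z‖ ^ 2) complexGaussian := by
  refine (integrable_exp_norm_sq.const_mul 2).mono' (by fun_prop)
    (Filter.Eventually.of_forall fun z => ?_)
  rw [Real.norm_of_nonneg (by positivity)]
  linarith [Real.add_one_le_exp (‖z‖ ^ 2 / 2)]

instance : NullSingletonClass (gaussianReal 0 (1 / 2)) :=
  nullSingletonClass_gaussianReal (by norm_num)

instance : NullSingletonClass (complexGaussian.map fun z : ℂ => ‖z‖ ^ 2) := by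
  refine ⟨fun c => ?_⟩
  have hm : Measurable fun p : ℝ × ℝ => p.1 ^ 2 + p.2 ^ 2 := by fun_prop
  have hc : ((fun z : ℂ => ‖z‖ ^ 2) ∘ fun p : ℝ × ℝ => (p.1 : ℂ) + (p.2 : ℂ) * Complex.I)
      = fun p : ℝ × ℝ => p.1 ^ 2 + p.2 ^ 2 := by
    funext p
    rw [Function.comp, ← Complex.normSq_eq_norm_sq, Complex.normSq_add_mul_I]
  rw [complexGaussian, Measure.map_map (by fun_prop) (by fun_prop), hc,
    Measure.map_apply hm (measurableSet_singleton c),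
    Measure.measure_prod_null (hm (measurableSet_singleton c))]
  refine Filter.Eventually.of_forall fun x => ?_
  -- A vertical line meets the circle of squared radius c in at most two points, which a real
  -- Gaussian does not charge.
  refine measure_mono_null (t := {√(c - x ^ 2), -√(c - x ^ 2)}) (fun y hy => ?_)
    ((Set.toFinite _).measure_zero _)
  have hy : x ^ 2 + y ^ 2 = c := hy
  have h : y ^ 2 = √(c - x ^ 2) ^ 2 := by
    rw [Real.sq_sqrt (by nlinarith)]
    linarith
  exact sq_eq_sq_iff_eq_or_eq_neg.1 h

/-- The mean absolute difference `𝔼 ||g|² - |h|²|` for independent complex Gaussians. -/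
def gaussianSNR : ℝ := ∫ p : ℂ × ℂ, |‖p.1‖ ^ 2 - ‖p.2‖ ^ 2| ∂(complexGaussian.prod complexGaussian)

lemma gaussianSNR_pos : 0 < gaussianSNR := by
  have hm : Measurable fun z : ℂ => ‖z‖ ^ 2 := by fun_prop
  have := Measure.isProbabilityMeasure_map (μ := complexGaussian) hm.aemeasurable
  have h := integral_abs_sub_prod_pos (μ := complexGaussian.map fun z : ℂ => ‖z‖ ^ 2)
    ((integrable_map_measure (by fun_prop) hm.aemeasurable).2 integrable_norm_sq_complexGaussian)
  rwa [Measure.map_prod_map _ _ hm hm, integral_map (by fun_prop) (by fun_prop)] at h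

variable {n : ℕ}

lemma continuous_intensity (x : EuclideanSpace ℂ (Fin n)) :
    Continuous fun a : EuclideanSpace ℂ (Fin n) => intensity a x := by
  unfold intensity; fun_prop

lemma intensity_eq_norm_inner_right (a x : EuclideanSpace ℂ (Fin n)) :
    intensity a x = ‖inner ℂ x a‖ ^ 2 := by
  rw [intensity, norm_inner_symm]

lemma intensity_nonneg (a x : EuclideanSpace ℂ (Fin n)) : 0 ≤ intensity a x := sq_nonneg _

lemma map_intensity (x : EuclideanSpace ℂ (Fin n)) :
    (complexGaussianVec n).map (fun a => intensity a x)
      = complexGaussian.map fun z => ‖x‖ ^ 2 * ‖z‖ ^ 2 := by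
  have h := congrArg (Measure.map fun z : ℂ => ‖z‖ ^ 2) (map_inner_complexGaussianVec x)
  rw [Measure.map_map (by fun_prop) (by fun_prop), Measure.map_map (by fun_prop) (by fun_prop)] at h
  convert h using 2
  · funext a
    exact intensity_eq_norm_inner_right a x
  · funext z
    simp [mul_pow]

lemma integrable_comp_intensity_iff (x : EuclideanSpace ℂ (Fin n)) {f : ℝ → ℝ} (hf : Measurable f) :
    Integrable (fun a => f (intensity a x)) (complexGaussianVec n)
      ↔ Integrable (fun z : ℂ => f (‖x‖ ^ 2 * ‖z‖ ^ 2)) complexGaussian := by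
  have h1 := integrable_map_measure (μ := complexGaussianVec n) (f := fun a => intensity a x)
    (g := f) hf.aestronglyMeasurable (continuous_intensity x).measurable.aemeasurable
  rw [map_intensity, integrable_map_measure hf.aestronglyMeasurable (by fun_prop)] at h1
  exact h1.symm

lemma integral_comp_intensity (x : EuclideanSpace ℂ (Fin n)) {f : ℝ → ℝ} (hf : Measurable f) :
    ∫ a, f (intensity a x) ∂(complexGaussianVec n)
      = ∫ z : ℂ, f (‖x‖ ^ 2 * ‖z‖ ^ 2) ∂complexGaussian := by
  rw [← integral_map (φ := fun a => intensity a x)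
    (continuous_intensity x).measurable.aemeasurable hf.aestronglyMeasurable,
    map_intensity, integral_map (by fun_prop) hf.aestronglyMeasurable]

lemma integrable_intensity (x : EuclideanSpace ℂ (Fin n)) :
    Integrable (fun a => intensity a x) (complexGaussianVec n) :=
  (integrable_comp_intensity_iff x measurable_id).2
    (integrable_norm_sq_complexGaussian.const_mul _)

lemma exp_mul_norm_sq_le {x : EuclideanSpace ℂ (Fin n)} {t : ℝ} (ht : t * ‖x‖ ^ 2 ≤ 1 / 2) (z : ℂ) :
    Real.exp (t * (‖x‖ ^ 2 * ‖z‖ ^ 2)) ≤ Real.exp (‖z‖ ^ 2 / 2) := by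
  refine Real.exp_le_exp.2 ?_
  nlinarith [sq_nonneg ‖z‖]

lemma integrable_exp_intensity {x : EuclideanSpace ℂ (Fin n)} {t : ℝ}
    (ht : t * ‖x‖ ^ 2 ≤ 1 / 2) :
    Integrable (fun a => Real.exp (t * intensity a x)) (complexGaussianVec n) := by
  refine (integrable_comp_intensity_iff x (f := fun s => Real.exp (t * s)) (by fun_prop)).2 ?_
  refine integrable_exp_norm_sq.mono' (by fun_prop) (Filter.Eventually.of_forall fun z => ?_)
  rw [Real.norm_of_nonneg (Real.exp_pos _).le]
  exact exp_mul_norm_sq_le ht z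

lemma integral_exp_intensity_le {x : EuclideanSpace ℂ (Fin n)} {t : ℝ}
    (ht : t * ‖x‖ ^ 2 ≤ 1 / 2) :
    ∫ a, Real.exp (t * intensity a x) ∂(complexGaussianVec n) ≤ gaussianExpMoment := by
  rw [integral_comp_intensity x (f := fun s => Real.exp (t * s)) (by fun_prop)]
  exact integral_mono_of_nonneg (Filter.Eventually.of_forall fun _ => (Real.exp_pos _).le)
    integrable_exp_norm_sq (Filter.Eventually.of_forall (exp_mul_norm_sq_le ht))

end Moments

/-! ### The mean of the empirical quadratic form -/

section Mean

variable {n : ℕ}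

/-- The summand `y (|⟨a¹, x⟩|² - |⟨a², x⟩|²)` of the empirical quadratic form, where `y` is the
ordering bit of the intensities along `x₀`. -/
def bitForm (x₀ x : EuclideanSpace ℂ (Fin n))
    (p : EuclideanSpace ℂ (Fin n) × EuclideanSpace ℂ (Fin n)) : ℝ :=
  Real.sign (intensity p.1 x₀ - intensity p.2 x₀) * (intensity p.1 x - intensity p.2 x)

lemma measurable_sign : Measurable Real.sign := by
  unfold Real.sign
  exact Measurable.ite measurableSet_Iio measurable_const
    (Measurable.ite measurableSet_Ioi measurable_const measurable_const)

lemma abs_sign_le_one (r : ℝ) : |Real.sign r| ≤ 1 := by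
  rcases Real.sign_apply_eq r with h | h | h <;> simp [h]

lemma measurable_bitForm (x₀ x : EuclideanSpace ℂ (Fin n)) : Measurable (bitForm x₀ x) := by
  have h := fun y : EuclideanSpace ℂ (Fin n) => (continuous_intensity y).measurable
  exact (measurable_sign.comp (((h x₀).comp measurable_fst).sub ((h x₀).comp measurable_snd))).mul
    (((h x).comp measurable_fst).sub ((h x).comp measurable_snd))

lemma abs_bitForm_le (x₀ x : EuclideanSpace ℂ (Fin n))
    (p : EuclideanSpace ℂ (Fin n) × EuclideanSpace ℂ (Fin n)) :
    |bitForm x₀ x p| ≤ intensity p.1 x + intensity p.2 x := by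
  rw [bitForm, abs_mul]
  refine (mul_le_of_le_one_left (abs_nonneg _) (abs_sign_le_one _)).trans ?_
  rw [abs_le]
  constructor <;> linarith [intensity_nonneg p.1 x, intensity_nonneg p.2 x]

lemma integrable_bitForm (x₀ x : EuclideanSpace ℂ (Fin n)) :
    Integrable (bitForm x₀ x) ((complexGaussianVec n).prod (complexGaussianVec n)) :=
  (((integrable_intensity x).comp_fst _).add ((integrable_intensity x).comp_snd _)).mono'
    (measurable_bitForm x₀ x).aestronglyMeasurable
    (Filter.Eventually.of_forall (abs_bitForm_le x₀ x))

lemma sign_mul_self_eq_abs (r : ℝ) : Real.sign r * r = |r| := by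
  rcases lt_trichotomy r 0 with h | h | h
  · rw [Real.sign_of_neg h, abs_of_neg h]; ring
  · simp [h]
  · rw [Real.sign_of_pos h, abs_of_pos h]; ring

lemma integral_bitForm_self {x₀ : EuclideanSpace ℂ (Fin n)} (hx₀ : ‖x₀‖ = 1) :
    ∫ p, bitForm x₀ x₀ p ∂((complexGaussianVec n).prod (complexGaussianVec n)) = gaussianSNR := by
  have hi := (continuous_intensity x₀).measurable
  have hm : Measurable fun z : ℂ => ‖z‖ ^ 2 := by fun_prop
  have hl := map_intensity x₀
  simp only [hx₀, one_pow, one_mul] at hl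
  have h : ∀ μ : Measure (ℝ × ℝ), AEStronglyMeasurable (fun q : ℝ × ℝ => |q.1 - q.2|) μ :=
    fun μ => by fun_prop
  simp only [bitForm, sign_mul_self_eq_abs]
  have h1 := integral_map (hi.prodMap hi).aemeasurable
    (h (((complexGaussianVec n).prod (complexGaussianVec n)).map _))
  have h2 := integral_map (hm.prodMap hm).aemeasurable
    (h ((complexGaussian.prod complexGaussian).map _))
  rw [← Measure.map_prod_map _ _ hi hi, hl] at h1
  rw [← Measure.map_prod_map _ _ hm hm] at h2
  exact h1.symm.trans h2

lemma integral_eq_zero_of_measurePreserving_neg {X : Type*} [MeasurableSpace X] {μ : Measure X}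
    {T : X → X} (hT : MeasurePreserving T μ μ) {f : X → ℝ} (hf : AEStronglyMeasurable f μ)
    (h : ∀ x, f (T x) = -f x) : ∫ x, f x ∂μ = 0 := by
  have h1 : ∫ x, f (T x) ∂μ = ∫ x, f x ∂μ := by
    conv_rhs => rw [← hT.map_eq]
    rw [integral_map hT.measurable.aemeasurable (by rwa [hT.map_eq])]
  simp only [h, integral_neg] at h1
  linarith

lemma inner_starProjection_span (x₀ u : EuclideanSpace ℂ (Fin n)) :
    (inner ℂ ((ℂ ∙ x₀).starProjection u) x₀ : ℂ) = inner ℂ u x₀ := by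
  rw [Submodule.inner_starProjection_left_eq_right,
    Submodule.starProjection_eq_self_iff.2 (Submodule.mem_span_singleton_self x₀)]

lemma starProjection_span_of_inner_eq_zero {x₀ w : EuclideanSpace ℂ (Fin n)}
    (hw : (inner ℂ x₀ w : ℂ) = 0) : (ℂ ∙ x₀).starProjection w = 0 := by
  rw [Submodule.starProjection_apply_eq_zero_iff, Submodule.mem_orthogonal_singleton_iff_inner_right]
  exact hw

/-- Exchange the components of the two vectors orthogonal to x₀, then rename: the map fixes the law,
and up to exchanging the pair it keeps one of the two intensity differences (along x₀, along w) and
reverses the other, so `bitForm x₀ w` changes sign. -/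
lemma integral_bitForm_of_inner_eq_zero {x₀ w : EuclideanSpace ℂ (Fin n)}
    (hw : (inner ℂ x₀ w : ℂ) = 0) :
    ∫ p, bitForm x₀ w p ∂((complexGaussianVec n).prod (complexGaussianVec n)) = 0 := by
  refine integral_eq_zero_of_measurePreserving_neg (measurePreserving_swapOrthogonal (ℂ ∙ x₀))
    (measurable_bitForm x₀ w).aestronglyMeasurable fun p => ?_
  have h : ∀ u, (inner ℂ ((ℂ ∙ x₀).starProjection u) w : ℂ) = 0 := fun u => by
    rw [Submodule.inner_starProjection_left_eq_right, starProjection_span_of_inner_eq_zero hw,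
      inner_zero_right]
  simp only [bitForm, intensity, swapOrthogonal, inner_add_left, inner_sub_left, h,
    inner_starProjection_span]
  simp only [add_zero, sub_zero]
  ring_nf

/-- Write x = c x₀ + w with w ⊥ x₀. The x₀ part gives ‖c‖² S, the w part has mean zero, and the
cross term is odd under the reflection fixing x₀ and negating w. -/
lemma integral_bitForm {x₀ : EuclideanSpace ℂ (Fin n)} (hx₀ : ‖x₀‖ = 1)
    (x : EuclideanSpace ℂ (Fin n)) :
    ∫ p, bitForm x₀ x p ∂((complexGaussianVec n).prod (complexGaussianVec n))
      = gaussianSNR * intensity x x₀ := by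
  set μ := (complexGaussianVec n).prod (complexGaussianVec n)
  set c : ℂ := inner ℂ x₀ x
  set w := x - c • x₀ with hwd
  have hw : (inner ℂ x₀ w : ℂ) = 0 := by
    rw [hwd, inner_sub_right, inner_smul_right, inner_self_eq_norm_sq_to_K, hx₀]
    simp [c]
  have hx : x = c • x₀ + w := by rw [hwd]; abel
  let U := (ℂ ∙ x₀).reflection
  have hU : MeasurePreserving (Prod.map U U) μ μ :=
    (measurePreserving_linearIsometryEquiv U).prod (measurePreserving_linearIsometryEquiv U)
  have hU0 : ∀ a, (inner ℂ (U a) x₀ : ℂ) = inner ℂ a x₀ := fun a => by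
    conv_lhs => rw [← Submodule.reflection_mem_subspace_eq_self
      (Submodule.mem_span_singleton_self (R := ℂ) x₀)]
    exact U.inner_map_map a x₀
  have hUw : ∀ a, (inner ℂ (U a) w : ℂ) = -inner ℂ a w := fun a => by
    have h : U w = -w := Submodule.reflection_mem_subspace_orthogonalComplement_eq_neg
      (Submodule.mem_orthogonal_singleton_iff_inner_right.2 hw)
    have h2 := U.inner_map_map a w
    rw [h, inner_neg_right] at h2
    rw [← h2, neg_neg]
  have hsplit : ∀ a, intensity a x = ‖c‖ ^ 2 * intensity a x₀ + intensity a w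
      + 2 * (star (c * inner ℂ a x₀) * inner ℂ a w : ℂ).re := fun a => by
    rw [intensity, hx, inner_add_right, inner_smul_right, intensity, intensity, ← mul_pow,
      ← norm_mul, ← Complex.normSq_eq_norm_sq, ← Complex.normSq_eq_norm_sq,
      ← Complex.normSq_eq_norm_sq, Complex.normSq_add]
    simp only [Complex.mul_re, Complex.conj_re, Complex.conj_im, Complex.star_def]
    ring
  have hcross : ∫ p, (bitForm x₀ x p - ‖c‖ ^ 2 * bitForm x₀ x₀ p - bitForm x₀ w p) ∂μ = 0 := by
    refine integral_eq_zero_of_measurePreserving_neg hU ?_ fun p => ?_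
    · exact (((measurable_bitForm x₀ x).sub ((measurable_bitForm x₀ x₀).const_mul _)).sub
        (measurable_bitForm x₀ w)).aestronglyMeasurable
    · have h0 : ∀ a, intensity (U a) x₀ = intensity a x₀ := fun a => by
        rw [intensity, hU0, intensity]
      simp only [bitForm, hsplit, Prod.map_fst, Prod.map_snd, h0, hU0, hUw, mul_neg,
        Complex.neg_re]
      ring
  have h1 : Integrable (fun p => bitForm x₀ x p - ‖c‖ ^ 2 * bitForm x₀ x₀ p) μ :=
    (integrable_bitForm x₀ x).sub ((integrable_bitForm x₀ x₀).const_mul _)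
  rw [integral_sub h1 (integrable_bitForm x₀ w), integral_sub (integrable_bitForm x₀ x)
    ((integrable_bitForm x₀ x₀).const_mul _), integral_const_mul, integral_bitForm_self hx₀,
    integral_bitForm_of_inner_eq_zero hw] at hcross
  rw [intensity_eq_norm_inner_right]
  linarith

end Mean

/-! ### Chernoff bounds for centred variables with an exponential moment -/

section Bernstein

lemma exp_le_one_add_add_sq_mul_exp_abs (u : ℝ) :
    Real.exp u ≤ 1 + u + u ^ 2 * Real.exp |u| := by
  have h := Complex.norm_exp_sub_sum_le_norm_mul_exp (u : ℂ) 2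
  simp only [Finset.sum_range_succ, Finset.sum_range_zero, pow_zero, pow_one, Nat.factorial,
    Complex.norm_real, Real.norm_eq_abs, sq_abs] at h
  have h2 : Complex.exp u - (0 + 1 / ((1 : ℕ) : ℂ) + (u : ℂ) / ((1 * (0 + 1) : ℕ) : ℂ))
      = ((Real.exp u - (1 + u) : ℝ) : ℂ) := by push_cast; ring
  have h3 := (le_abs_self _).trans_eq (Complex.norm_real (Real.exp u - (1 + u))).symm
  rw [← h2] at h3
  have := h3.trans h
  linarith

variable {X : Type*} [MeasurableSpace X] {ν : Measure X}

/-- One factor exp(s₀w) bounds the exponential in the Taylor remainder, a second one absorbs z²;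
hence the 2s₀ in the moment required below. -/
lemma exp_mul_le_of_abs_le {z w s s₀ : ℝ} (hs₀ : 0 < s₀) (hs : |s| ≤ s₀) (hz : |z| ≤ w) :
    Real.exp (s * z) ≤ 1 + s * z + 2 / s₀ ^ 2 * s ^ 2 * Real.exp (2 * s₀ * w) := by
  refine (exp_le_one_add_add_sq_mul_exp_abs (s * z)).trans ?_
  have h0 : 0 ≤ s₀ * w := mul_nonneg hs₀.le ((abs_nonneg z).trans hz)
  have h1 : Real.exp |s * z| ≤ Real.exp (s₀ * w) := by
    rw [Real.exp_le_exp, abs_mul]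
    exact mul_le_mul hs hz (abs_nonneg _) hs₀.le
  have h2 : z ^ 2 ≤ w ^ 2 := by
    rw [← sq_abs z]
    exact pow_le_pow_left₀ (abs_nonneg z) hz 2
  have h3 : (s₀ * w) ^ 2 ≤ 2 * Real.exp (s₀ * w) := by
    linarith [Real.quadratic_le_exp_of_nonneg h0]
  have h4 : z ^ 2 ≤ 2 / s₀ ^ 2 * Real.exp (s₀ * w) := by
    rw [div_mul_eq_mul_div, le_div_iff₀ (by positivity)]
    nlinarith [sq_nonneg s₀]
  have h5 : Real.exp (2 * s₀ * w) = Real.exp (s₀ * w) * Real.exp (s₀ * w) := by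
    rw [← Real.exp_add]; ring_nf
  have h6 : (s * z) ^ 2 * Real.exp |s * z|
      ≤ s ^ 2 * (2 / s₀ ^ 2 * Real.exp (s₀ * w)) * Real.exp (s₀ * w) := by
    rw [mul_pow]
    gcongr
  rw [h5]
  linarith

lemma integrable_exp_mul_of_abs_le {Z W : X → ℝ} {s₀ s : ℝ} (hs₀ : 0 < s₀)
    (hZ : Measurable Z) (hZW : ∀ x, |Z x| ≤ W x)
    (hW : Integrable (fun x => Real.exp (2 * s₀ * W x)) ν) (hs : |s| ≤ s₀) :
    Integrable (fun x => Real.exp (s * Z x)) ν := by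
  refine hW.mono' (by fun_prop) (Filter.Eventually.of_forall fun x => ?_)
  rw [Real.norm_of_nonneg (Real.exp_pos _).le, Real.exp_le_exp]
  have h1 : s * Z x ≤ s₀ * W x :=
    (le_abs_self _).trans ((abs_mul _ _).trans_le (mul_le_mul hs (hZW x) (abs_nonneg _) hs₀.le))
  have h2 : 0 ≤ s₀ * W x := mul_nonneg hs₀.le ((abs_nonneg _).trans (hZW x))
  linarith

variable [IsProbabilityMeasure ν]

lemma mgf_le_exp_of_abs_le {Z W : X → ℝ} {s₀ s M : ℝ} (hs₀ : 0 < s₀)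
    (hZ : Measurable Z) (hZ0 : ∫ x, Z x ∂ν = 0) (hZi : Integrable Z ν) (hZW : ∀ x, |Z x| ≤ W x)
    (hW : Integrable (fun x => Real.exp (2 * s₀ * W x)) ν)
    (hM : ∫ x, Real.exp (2 * s₀ * W x) ∂ν ≤ M) (hs : |s| ≤ s₀) :
    mgf Z ν s ≤ Real.exp (2 * M / s₀ ^ 2 * s ^ 2) := by
  have h1 : Integrable (fun x => 1 + s * Z x) ν := (integrable_const 1).add (hZi.const_mul s)
  have h2 : Integrable (fun x => 2 / s₀ ^ 2 * s ^ 2 * Real.exp (2 * s₀ * W x)) ν := hW.const_mul _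
  have h : mgf Z ν s
      ≤ ∫ x, (1 + s * Z x + 2 / s₀ ^ 2 * s ^ 2 * Real.exp (2 * s₀ * W x)) ∂ν :=
    integral_mono (integrable_exp_mul_of_abs_le hs₀ hZ hZW hW hs) (h1.add h2)
      fun x => exp_mul_le_of_abs_le hs₀ hs (hZW x)
  rw [integral_add h1 h2, integral_add (integrable_const 1) (hZi.const_mul s), integral_const_mul,
    integral_const_mul, hZ0] at h
  have h3 : 2 / s₀ ^ 2 * s ^ 2 * ∫ x, Real.exp (2 * s₀ * W x) ∂ν ≤ 2 / s₀ ^ 2 * s ^ 2 * M := by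
    gcongr
  have h4 := Real.add_one_le_exp (2 * M / s₀ ^ 2 * s ^ 2)
  have h5 : 2 / s₀ ^ 2 * s ^ 2 * M = 2 * M / s₀ ^ 2 * s ^ 2 := by ring
  simp at h
  linarith

lemma measureReal_sum_ge_le {Z : X → ℝ} (hZ : Measurable Z) {V s₀ δ : ℝ} (hV : 0 < V)
    (hint : ∀ s, |s| ≤ s₀ → Integrable (fun x => Real.exp (s * Z x)) ν)
    (hmgf : ∀ s, |s| ≤ s₀ → mgf Z ν s ≤ Real.exp (V * s ^ 2))
    (hδ : 0 ≤ δ) (hδs : δ ≤ 2 * V * s₀) (m : ℕ) :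
    (Measure.pi fun _ : Fin m => ν).real {b | m * δ ≤ ∑ i, Z (b i)}
      ≤ Real.exp (-(m * δ ^ 2 / (4 * V))) := by
  -- The minimizer of -sδ + Vs².
  set s := δ / (2 * V)
  have hs0 : 0 ≤ s := by positivity
  have hs : |s| ≤ s₀ := by
    rw [abs_of_nonneg hs0, div_le_iff₀ (by positivity)]
    linarith
  have hind : iIndepFun (fun (i : Fin m) (b : Fin m → X) => Z (b i)) (Measure.pi fun _ => ν) :=
    iIndepFun_pi (X := fun _ => Z) fun _ => hZ.aemeasurable
  have hmeas : ∀ i : Fin m, Measurable fun b : Fin m → X => Z (b i) := fun i =>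
    hZ.comp (measurable_pi_apply i)
  have hone : ∀ i : Fin m, mgf (fun b : Fin m → X => Z (b i)) (Measure.pi fun _ => ν) s
      = mgf Z ν s := fun i =>
    integral_comp_eval (μ := fun _ : Fin m => ν) (i := i) (f := fun x => Real.exp (s * Z x))
      (by fun_prop)
  have hsumeq : (∑ i, fun b : Fin m → X => Z (b i)) = fun b => ∑ i, Z (b i) := by
    ext b; simp
  have h := hind.mgf_sum (t := s) hmeas Finset.univ
  have hi := hind.integrable_exp_mul_sum (t := s) hmeas (s := Finset.univ)
    fun i _ => integrable_comp_eval (μ := fun _ : Fin m => ν) (i := i)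
      (f := fun x => Real.exp (s * Z x)) (hint s hs)
  rw [hsumeq] at h hi
  refine (measure_ge_le_exp_mul_mgf (m * δ) hs0 hi).trans ?_
  rw [h, Finset.prod_congr rfl fun i _ => hone i, Finset.prod_const, Finset.card_univ,
    Fintype.card_fin]
  calc Real.exp (-s * (m * δ)) * mgf Z ν s ^ m
      ≤ Real.exp (-s * (m * δ)) * Real.exp (V * s ^ 2) ^ m := by
        gcongr
        · exact mgf_nonneg
        · exact hmgf s hs
    _ = Real.exp (-(m * δ ^ 2 / (4 * V))) := by
        rw [← Real.exp_nat_mul, ← Real.exp_add]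
        congr 1
        simp only [s]
        field_simp
        ring

lemma measureReal_abs_sum_ge_le {Z : X → ℝ} (hZ : Measurable Z) {V s₀ δ : ℝ} (hV : 0 < V)
    (hint : ∀ s, |s| ≤ s₀ → Integrable (fun x => Real.exp (s * Z x)) ν)
    (hmgf : ∀ s, |s| ≤ s₀ → mgf Z ν s ≤ Real.exp (V * s ^ 2))
    (hδ : 0 ≤ δ) (hδs : δ ≤ 2 * V * s₀) (m : ℕ) :
    (Measure.pi fun _ : Fin m => ν).real {b | m * δ ≤ |∑ i, Z (b i)|}
      ≤ 2 * Real.exp (-(m * δ ^ 2 / (4 * V))) := by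
  have h1 := measureReal_sum_ge_le hZ hV hint hmgf hδ hδs m
  have h2 := measureReal_sum_ge_le (ν := ν) (Z := fun x => -Z x) hZ.neg hV
    (fun s hs => by simpa using hint (-s) (by rwa [abs_neg]))
    (fun s hs => by
      have := hmgf (-s) (by rwa [abs_neg])
      rwa [← mgf_neg, neg_sq] at this) hδ hδs m
  have hsub : {b : Fin m → X | m * δ ≤ |∑ i, Z (b i)|}
      ⊆ {b | m * δ ≤ ∑ i, Z (b i)} ∪ {b | m * δ ≤ ∑ i, -Z (b i)} := by
    intro b hb
    simp only [Set.mem_union, Set.mem_ofPred_eq, Finset.sum_neg_distrib] at hb ⊢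
    exact le_abs.1 hb
  refine (measureReal_mono hsub).trans ((measureReal_union_le _ _).trans ?_)
  linarith

end Bernstein

/-! ### Concentration at a fixed point -/

section Concentration

variable {n : ℕ}

/-- The variance proxy of `bitForm x₀ x - 𝔼 bitForm x₀ x` for `‖x‖² ≤ 25 / 16`. -/
def varianceProxy : ℝ := 128 * (gaussianExpMoment ^ 2 * Real.exp gaussianSNR)

lemma gaussianSNR_le_varianceProxy : 128 * gaussianSNR ≤ varianceProxy := by
  have h1 := one_le_gaussianExpMoment
  have h2 := Real.add_one_le_exp gaussianSNR
  have h3 := gaussianSNR_pos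
  unfold varianceProxy
  nlinarith [one_le_pow₀ (n := 2) h1, Real.exp_pos gaussianSNR]

lemma varianceProxy_pos : 0 < varianceProxy := by
  linarith [gaussianSNR_pos, gaussianSNR_le_varianceProxy]

lemma measureReal_abs_sum_bitForm_sub_ge_le {x₀ x : EuclideanSpace ℂ (Fin n)} (hx₀ : ‖x₀‖ = 1)
    (hx : ‖x‖ ^ 2 ≤ 25 / 16) {δ : ℝ} (hδ : 0 ≤ δ) (hδ1 : δ ≤ gaussianSNR) (m : ℕ) :
    (Measure.pi fun _ : Fin m => (complexGaussianVec n).prod (complexGaussianVec n)).real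
        {b | m * δ ≤ |∑ i, (bitForm x₀ x (b i) - gaussianSNR * intensity x x₀)|}
      ≤ 2 * Real.exp (-(m * δ ^ 2 / (4 * varianceProxy))) := by
  set μ := complexGaussianVec n
  have hI : intensity x x₀ ≤ 25 / 16 := by
    have h := norm_inner_le_norm (𝕜 := ℂ) x x₀
    rw [hx₀, mul_one] at h
    exact (pow_le_pow_left₀ (norm_nonneg _) h 2).trans hx
  have hI0 := intensity_nonneg x x₀
  have hS := gaussianSNR_pos
  set W : EuclideanSpace ℂ (Fin n) × EuclideanSpace ℂ (Fin n) → ℝ :=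
    fun p => intensity p.1 x + intensity p.2 x + gaussianSNR * (25 / 16)
  have hZ : Measurable fun p => bitForm x₀ x p - gaussianSNR * intensity x x₀ :=
    (measurable_bitForm x₀ x).sub_const _
  have hZi : Integrable (fun p => bitForm x₀ x p - gaussianSNR * intensity x x₀) (μ.prod μ) :=
    (integrable_bitForm x₀ x).sub (integrable_const _)
  have hZ0 : ∫ p, (bitForm x₀ x p - gaussianSNR * intensity x x₀) ∂(μ.prod μ) = 0 := by
    rw [integral_sub (integrable_bitForm x₀ x) (integrable_const _), integral_bitForm hx₀]
    simp
  have hZW : ∀ p, |bitForm x₀ x p - gaussianSNR * intensity x x₀| ≤ W p := fun p => by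
    refine (abs_sub _ _).trans (add_le_add (abs_bitForm_le x₀ x p) ?_)
    rw [abs_of_nonneg (by positivity)]
    gcongr
  -- With s₀ = 1/8 the moment needed has exponent 2s₀ = 1/4, and 25/64 ≤ 1/2.
  have ht : 1 / 4 * ‖x‖ ^ 2 ≤ 1 / 2 := by linarith
  have hfac : ∀ p, Real.exp (2 * (1 / 8) * W p) = Real.exp (gaussianSNR * (25 / 64))
      * (Real.exp (1 / 4 * intensity p.1 x) * Real.exp (1 / 4 * intensity p.2 x)) := fun p => by
    rw [← Real.exp_add, ← Real.exp_add]
    congr 1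
    simp only [W]
    ring
  have hW : Integrable (fun p => Real.exp (2 * (1 / 8) * W p)) (μ.prod μ) := by
    simp_rw [hfac]
    exact ((integrable_exp_intensity ht).mul_prod (integrable_exp_intensity ht)).const_mul _
  have hM : ∫ p, Real.exp (2 * (1 / 8) * W p) ∂(μ.prod μ)
      ≤ gaussianExpMoment ^ 2 * Real.exp gaussianSNR := by
    simp_rw [hfac]
    rw [integral_const_mul, integral_prod_mul (fun a => Real.exp (1 / 4 * intensity a x))
      (fun a => Real.exp (1 / 4 * intensity a x)), mul_comm, ← sq]
    have h0 : 0 ≤ ∫ a, Real.exp (1 / 4 * intensity a x) ∂μ :=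
      integral_nonneg fun _ => (Real.exp_pos _).le
    gcongr
    · exact integral_exp_intensity_le ht
    · linarith
  have hV : 2 * (gaussianExpMoment ^ 2 * Real.exp gaussianSNR) / (1 / 8) ^ 2 = varianceProxy := by
    unfold varianceProxy; ring
  refine measureReal_abs_sum_ge_le (s₀ := 1 / 8) hZ varianceProxy_pos
    (fun s hs => integrable_exp_mul_of_abs_le (by norm_num) hZ hZW hW hs)
    (fun s hs => ?_) hδ ?_ m
  · rw [← hV]
    exact mgf_le_exp_of_abs_le (by norm_num) hZ hZ0 hZi hZW hW hM hs
  -- The Chernoff parameter stays within s₀ because δ ≤ S ≤ `varianceProxy` / 128.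
  · linarith [gaussianSNR_le_varianceProxy]

end Concentration

/-! ### Passing from a net to the sphere, and an explicit grid -/

section Net

variable {n : ℕ} {ι : Type*} [Fintype ι] {c : ι → ℝ} {b : ι → EuclideanSpace ℂ (Fin n)}

/-- Both sides equal 4 Re(u v̄), which is unchanged by scaling u by 1/3 and v by 3. -/
lemma norm_add_sq_sub_norm_sub_sq (u v : ℂ) :
    ‖u + v‖ ^ 2 - ‖u - v‖ ^ 2 = ‖(1 / 3 : ℂ) * u + 3 * v‖ ^ 2 - ‖(1 / 3 : ℂ) * u - 3 * v‖ ^ 2 := by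
  have h : (1 / 3 : ℂ) = ((1 / 3 : ℝ) : ℂ) := by push_cast; rfl
  rw [h]
  simp only [← Complex.normSq_eq_norm_sq, Complex.normSq_apply, Complex.add_re, Complex.add_im,
    Complex.sub_re, Complex.sub_im, Complex.mul_re, Complex.mul_im, Complex.ofReal_re,
    Complex.ofReal_im, Complex.re_ofNat, Complex.im_ofNat]
  ring

lemma sum_intensity_add_sub (p r : EuclideanSpace ℂ (Fin n)) :
    (∑ j, c j * intensity (b j) (p + r)) - ∑ j, c j * intensity (b j) (p - r)
      = (∑ j, c j * intensity (b j) ((1 / 3 : ℂ) • p + (3 : ℂ) • r))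
        - ∑ j, c j * intensity (b j) ((1 / 3 : ℂ) • p - (3 : ℂ) • r) := by
  rw [← Finset.sum_sub_distrib, ← Finset.sum_sub_distrib]
  refine Finset.sum_congr rfl fun j _ => ?_
  simp only [intensity, inner_add_right, inner_sub_right, inner_smul_right, ← mul_sub]
  rw [norm_add_sq_sub_norm_sub_sq]

lemma intensity_smul (a x : EuclideanSpace ℂ (Fin n)) (t : ℂ) :
    intensity a (t • x) = ‖t‖ ^ 2 * intensity a x := by
  rw [intensity, intensity, inner_smul_right, norm_mul, mul_pow]

lemma abs_sum_intensity_le_mul_norm_sq {S : ℝ}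
    (hS : ∀ x : EuclideanSpace ℂ (Fin n), ‖x‖ = 1 → |∑ j, c j * intensity (b j) x| ≤ S)
    (z : EuclideanSpace ℂ (Fin n)) : |∑ j, c j * intensity (b j) z| ≤ S * ‖z‖ ^ 2 := by
  rcases eq_or_ne z 0 with rfl | hz
  · simp [intensity]
  · have hz' : (‖z‖ : ℂ) ≠ 0 := by exact_mod_cast norm_ne_zero_iff.2 hz
    have hu := hS ((‖z‖ : ℂ)⁻¹ • z) (by
      rw [norm_smul, norm_inv, Complex.norm_real, norm_norm,
        inv_mul_cancel₀ (norm_ne_zero_iff.2 hz)])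
    have h : ∀ j, c j * intensity (b j) z
        = ‖z‖ ^ 2 * (c j * intensity (b j) ((‖z‖ : ℂ)⁻¹ • z)) := fun j => by
      have := intensity_smul (b j) ((‖z‖ : ℂ)⁻¹ • z) (‖z‖ : ℂ)
      rw [smul_inv_smul₀ hz', Complex.norm_real, norm_norm] at this
      rw [this]; ring
    simp_rw [h]
    rw [← Finset.mul_sum, abs_mul, abs_of_nonneg (sq_nonneg ‖z‖), mul_comm S]
    gcongr

lemma norm_add_sq_add_norm_sub_sq (u v : EuclideanSpace ℂ (Fin n)) :
    ‖u + v‖ ^ 2 + ‖u - v‖ ^ 2 = 2 * (‖u‖ ^ 2 + ‖v‖ ^ 2) := by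
  have := parallelogram_law_with_norm ℂ u v
  linarith

/-- With x = p + r and v = p - r, the difference is a polarized form in p and r. Rescaling by 1/3
and 3 balances the bounds 9/8 and 1/8 to 3/8 each, and the parallelogram law gives 2·2·(3/8)² =
9/16. -/
lemma abs_sum_intensity_sub_le {S : ℝ} (hS0 : 0 ≤ S)
    (hS : ∀ x : EuclideanSpace ℂ (Fin n), ‖x‖ = 1 → |∑ j, c j * intensity (b j) x| ≤ S)
    {x v : EuclideanSpace ℂ (Fin n)} (hx : ‖x‖ = 1) (hxv : ‖x - v‖ ≤ 1 / 4) :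
    |(∑ j, c j * intensity (b j) x) - ∑ j, c j * intensity (b j) v| ≤ 9 / 16 * S := by
  set p := (1 / 2 : ℂ) • (x + v)
  set r := (1 / 2 : ℂ) • (x - v)
  have hpr : p + r = x := by
    simp only [p, r]
    module
  have hpr' : p - r = v := by
    simp only [p, r]
    module
  have hv : ‖v‖ ≤ 5 / 4 := by
    have := norm_sub_norm_le v x
    rw [norm_sub_rev v x] at this
    linarith
  have hhalf : ‖(1 / 2 : ℂ)‖ = 1 / 2 := by norm_num
  have hthird : ‖(1 / 3 : ℂ)‖ = 1 / 3 := by norm_num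
  have hthree : ‖(3 : ℂ)‖ = 3 := by norm_num
  have hp : ‖p‖ ≤ 9 / 8 := by
    rw [norm_smul, hhalf]
    linarith [norm_add_le x v]
  have hr : ‖r‖ ≤ 1 / 8 := by
    rw [norm_smul, hhalf]
    linarith
  have hp2 : ‖(1 / 3 : ℂ) • p‖ ^ 2 ≤ (3 / 8) ^ 2 := by
    rw [norm_smul, hthird]
    exact pow_le_pow_left₀ (by positivity) (by linarith) 2
  have hr2 : ‖(3 : ℂ) • r‖ ^ 2 ≤ (3 / 8) ^ 2 := by
    rw [norm_smul, hthree]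
    exact pow_le_pow_left₀ (by positivity) (by linarith) 2
  have h := sum_intensity_add_sub (c := c) (b := b) p r
  rw [hpr, hpr'] at h
  rw [h]
  refine (abs_sub _ _).trans ((add_le_add (abs_sum_intensity_le_mul_norm_sq hS _)
    (abs_sum_intensity_le_mul_norm_sq hS _)).trans ?_)
  rw [← mul_add, norm_add_sq_add_norm_sub_sq]
  nlinarith

/-- At a maximizer on the sphere the bound S satisfies S ≤ δ + (9/16)S, so S ≤ (16/7)δ. -/
lemma abs_sum_intensity_le_of_net {N : Set (EuclideanSpace ℂ (Fin n))} {δ : ℝ}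
    (hN : ∀ x : EuclideanSpace ℂ (Fin n), ‖x‖ = 1 → ∃ v ∈ N, ‖x - v‖ ≤ 1 / 4)
    (hδ : ∀ v ∈ N, |∑ j, c j * intensity (b j) v| ≤ δ)
    {x : EuclideanSpace ℂ (Fin n)} (hx : ‖x‖ = 1) :
    |∑ j, c j * intensity (b j) x| ≤ 16 / 7 * δ := by
  have hcont : Continuous fun z : EuclideanSpace ℂ (Fin n) => |∑ j, c j * intensity (b j) z| := by
    unfold intensity; fun_prop
  obtain ⟨y, hy, hmax⟩ := (isCompact_sphere (0 : EuclideanSpace ℂ (Fin n)) 1).exists_isMaxOn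
    ⟨x, by simpa using hx⟩ hcont.continuousOn
  have hmax : ∀ z : EuclideanSpace ℂ (Fin n), ‖z‖ = 1 →
      |∑ j, c j * intensity (b j) z| ≤ |∑ j, c j * intensity (b j) y| :=
    fun z hz => hmax (by simpa using hz)
  have hy : ‖y‖ = 1 := by simpa using hy
  obtain ⟨v, hv, hyv⟩ := hN y hy
  have h1 := abs_sum_intensity_sub_le (abs_nonneg _) hmax hy hyv
  have h2 := hδ v hv
  have h3 := abs_sub_abs_le_abs_sub (∑ j, c j * intensity (b j) y) (∑ j, c j * intensity (b j) v)
  linarith [hmax x hx]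

/-- The point of `ℂⁿ` whose real and imaginary coordinates are `k / (8 n) - 1`. -/
def gridPoint (k : Fin n → Fin (16 * n + 1) × Fin (16 * n + 1)) : EuclideanSpace ℂ (Fin n) :=
  WithLp.toLp 2 fun i =>
    ⟨((k i).1 : ℝ) / (8 * n) - 1, ((k i).2 : ℝ) / (8 * n) - 1⟩

lemma exists_fin_abs_sub_le {n : ℕ} (hn : 0 < n) {t : ℝ} (ht : |t| ≤ 1) :
    ∃ k : Fin (16 * n + 1), |t - ((k : ℝ) / (8 * n) - 1)| ≤ 1 / (8 * n) := by
  have hn' : (0 : ℝ) < 8 * n := by positivity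
  obtain ⟨h1, h2⟩ := abs_le.1 ht
  have h0 : 0 ≤ (t + 1) * (8 * n) := mul_nonneg (by linarith) hn'.le
  have hlt : ⌊(t + 1) * (8 * n)⌋₊ < 16 * n + 1 := by
    refine Nat.lt_succ_of_le (Nat.floor_le_of_le ?_)
    push_cast
    nlinarith
  refine ⟨⟨_, hlt⟩, ?_⟩
  have h3 := Nat.floor_le h0
  have h4 := Nat.lt_floor_add_one ((t + 1) * (8 * n))
  have h5 : t - ((⌊(t + 1) * (8 * n)⌋₊ : ℝ) / (8 * n) - 1)
      = ((t + 1) * (8 * n) - ⌊(t + 1) * (8 * n)⌋₊) / (8 * n) := by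
    field_simp
    ring
  rw [h5, abs_of_nonneg (div_nonneg (by linarith) hn'.le)]
  exact div_le_div_of_nonneg_right (by linarith) hn'.le

lemma exists_gridPoint_norm_sub_le (hn : 0 < n) {x : EuclideanSpace ℂ (Fin n)} (hx : ‖x‖ = 1) :
    ∃ k, ‖x - gridPoint k‖ ≤ 1 / 4 := by
  have hxi : ∀ i, ‖x i‖ ≤ 1 := fun i => hx ▸ PiLp.norm_apply_le x i
  choose k hk using fun i => exists_fin_abs_sub_le hn ((Complex.abs_re_le_norm _).trans (hxi i))
  choose l hl using fun i => exists_fin_abs_sub_le hn ((Complex.abs_im_le_norm _).trans (hxi i))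
  refine ⟨fun i => (k i, l i), abs_le_of_sq_le_sq' ?_ (by norm_num) |>.2⟩
  have hn' : (1 : ℝ) ≤ n := by exact_mod_cast hn
  have hterm : ∀ i, ‖(x - gridPoint fun i => (k i, l i)) i‖ ^ 2 ≤ 2 * (1 / (8 * n)) ^ 2 := fun i => by
    have h1 := sq_le_sq' (abs_le.1 (hk i)).1 (abs_le.1 (hk i)).2
    have h2 := sq_le_sq' (abs_le.1 (hl i)).1 (abs_le.1 (hl i)).2
    rw [← Complex.normSq_eq_norm_sq, Complex.normSq_apply, ← sq, ← sq]
    exact (add_le_add h1 h2).trans_eq (two_mul _).symm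
  rw [EuclideanSpace.norm_sq_eq]
  refine (Finset.sum_le_card_nsmul _ _ _ fun i _ => hterm i).trans ?_
  rw [Finset.card_univ, Fintype.card_fin, nsmul_eq_mul]
  -- The squared distance is at most 1/(32n), below the required 1/16.
  have : (n : ℝ) * (2 * (1 / (8 * n)) ^ 2) = 1 / 32 * (1 / n) := by field_simp; norm_num
  rw [this]
  have : 1 / (n : ℝ) ≤ 1 := by rw [div_le_one (by linarith)]; exact hn'
  linarith

end Net

/-! ### Uniform deviation over the sphere -/

section Uniform

variable {n m : ℕ}

/-- The samples for which the empirical form deviates by at least `δ` from its mean at some point of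
the grid. -/
def gridDeviation (x₀ : EuclideanSpace ℂ (Fin n)) (m : ℕ) (δ : ℝ) :
    Set (Fin m → EuclideanSpace ℂ (Fin n) × EuclideanSpace ℂ (Fin n)) :=
  ⋃ k ∈ {k : Fin n → Fin (16 * n + 1) × Fin (16 * n + 1) | ‖gridPoint k‖ ^ 2 ≤ 25 / 16},
    {b | m * δ ≤ |∑ i, (bitForm x₀ (gridPoint k) (b i) - gaussianSNR * intensity (gridPoint k) x₀)|}

lemma measurableSet_gridDeviation (x₀ : EuclideanSpace ℂ (Fin n)) (m : ℕ) (δ : ℝ) :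
    MeasurableSet (gridDeviation x₀ m δ) := by
  refine MeasurableSet.biUnion (Set.toFinite _).countable fun k _ => ?_
  have h : Measurable fun b : Fin m → EuclideanSpace ℂ (Fin n) × EuclideanSpace ℂ (Fin n) =>
      ∑ i, (bitForm x₀ (gridPoint k) (b i) - gaussianSNR * intensity (gridPoint k) x₀) :=
    Finset.measurable_sum _ fun i _ =>
      ((measurable_bitForm x₀ _).comp (measurable_pi_apply i)).sub_const _
  exact measurableSet_le measurable_const h.abs

lemma measureReal_gridDeviation_le {x₀ : EuclideanSpace ℂ (Fin n)} (hx₀ : ‖x₀‖ = 1) {δ : ℝ}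
    (hδ : 0 ≤ δ) (hδ1 : δ ≤ gaussianSNR) (m : ℕ) :
    (Measure.pi fun _ : Fin m => (complexGaussianVec n).prod (complexGaussianVec n)).real
        (gridDeviation x₀ m δ)
      ≤ (16 * n + 1) ^ (2 * n) * (2 * Real.exp (-(m * δ ^ 2 / (4 * varianceProxy)))) := by
  classical
  have h := measureReal_biUnion_finset_le
    (μ := Measure.pi fun _ : Fin m => (complexGaussianVec n).prod (complexGaussianVec n))
    (Finset.univ.filter fun k : Fin n → Fin (16 * n + 1) × Fin (16 * n + 1) =>
      ‖gridPoint k‖ ^ 2 ≤ 25 / 16)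
    fun k => {b | m * δ ≤ |∑ i, (bitForm x₀ (gridPoint k) (b i)
      - gaussianSNR * intensity (gridPoint k) x₀)|}
  simp only [Finset.mem_filter, Finset.mem_univ, true_and] at h
  refine h.trans ((Finset.sum_le_card_nsmul _ _ (2 * Real.exp (-(m * δ ^ 2 / (4 * varianceProxy))))
    fun k hk => measureReal_abs_sum_bitForm_sub_ge_le hx₀ (Finset.mem_filter.1 hk).2 hδ hδ1 m).trans
    ?_)
  rw [nsmul_eq_mul]
  gcongr
  refine (Nat.cast_le.2 (Finset.card_le_univ _)).trans_eq ?_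
  simp only [Fintype.card_pi, Fintype.card_prod, Fintype.card_fin, Finset.prod_const,
    Finset.card_univ]
  push_cast
  rw [← sq, ← pow_mul]

lemma abs_sum_bitForm_sub_le_of_notMem {x₀ : EuclideanSpace ℂ (Fin n)} {δ : ℝ} (hn : 0 < n)
    {p : Fin m → EuclideanSpace ℂ (Fin n) × EuclideanSpace ℂ (Fin n)}
    (hp : p ∉ gridDeviation x₀ m δ) {x : EuclideanSpace ℂ (Fin n)} (hx : ‖x‖ = 1) :
    |(∑ i, bitForm x₀ x (p i)) - m * (gaussianSNR * intensity x x₀)| ≤ 16 / 7 * (m * δ) := by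
  -- The mean enters as one more weighted intensity, with vector x₀, so the whole deviation is a
  -- single form to which the net argument applies.
  let c : (Fin m ⊕ Fin m) ⊕ Unit → ℝ :=
    Sum.elim (Sum.elim (fun i => Real.sign (intensity (p i).1 x₀ - intensity (p i).2 x₀))
      fun i => -Real.sign (intensity (p i).1 x₀ - intensity (p i).2 x₀))
      fun _ => -(m * gaussianSNR)
  let b : (Fin m ⊕ Fin m) ⊕ Unit → EuclideanSpace ℂ (Fin n) :=
    Sum.elim (Sum.elim (fun i => (p i).1) fun i => (p i).2) fun _ => x₀
  have hq : ∀ z, ∑ j, c j * intensity (b j) z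
      = (∑ i, bitForm x₀ z (p i)) - m * (gaussianSNR * intensity z x₀) := fun z => by
    simp only [Fintype.sum_sum_type, c, b, Sum.elim_inl, Sum.elim_inr, Finset.univ_unique,
      Finset.sum_singleton, bitForm, mul_sub, Finset.sum_sub_distrib, neg_mul,
      Finset.sum_neg_distrib, intensity, norm_inner_symm x₀ z]
    ring
  rw [← hq]
  refine abs_sum_intensity_le_of_net
    (N := {v | ∃ k, gridPoint k = v ∧ ‖gridPoint k‖ ^ 2 ≤ 25 / 16}) (fun z hz => ?_) ?_ hx
  · obtain ⟨k, hk⟩ := exists_gridPoint_norm_sub_le hn hz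
    refine ⟨gridPoint k, ⟨k, rfl, ?_⟩, hk⟩
    have h1 := norm_sub_norm_le (gridPoint k) z
    rw [norm_sub_rev] at h1
    have h2 : ‖gridPoint k‖ ≤ 5 / 4 := by linarith
    nlinarith [norm_nonneg (gridPoint k)]
  · rintro v ⟨k, rfl, hk⟩
    rw [hq]
    by_contra hcon
    refine hp (Set.mem_biUnion (x := k) hk ?_)
    rw [Set.mem_ofPred_eq, Finset.sum_sub_distrib]
    simpa using (not_le.1 hcon).le

end Uniform

/-! ### From uniform deviation to recovery -/

section Deterministic

variable {n m : ℕ}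

lemma quadForm_outer (a x : EuclideanSpace ℂ (Fin n)) : quadForm (outer a) x = intensity a x := by
  have h1 : (star a.ofLp ⬝ᵥ x.ofLp : ℂ) = inner ℂ a x := by
    rw [EuclideanSpace.inner_eq_star_dotProduct, dotProduct_comm]
  have h2 : (star x.ofLp ⬝ᵥ a.ofLp : ℂ) = (starRingEnd ℂ) (inner ℂ a x) := by
    rw [inner_conj_symm, EuclideanSpace.inner_eq_star_dotProduct, dotProduct_comm]
  rw [quadForm, outer, Matrix.vecMulVec_mulVec, dotProduct_smul, h1, h2, intensity,
    ← Complex.normSq_eq_norm_sq, MulOpposite.smul_eq_mul_unop, MulOpposite.unop_op,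
    mul_comm, Complex.mul_conj, Complex.ofReal_re]

lemma quadForm_empMatrix {α : ℝ} (hα : 0 < α) (x₀ x : EuclideanSpace ℂ (Fin n))
    (a : Fin m → Fin 2 → EuclideanSpace ℂ (Fin n)) :
    quadForm (empMatrix (clip α) x₀ a) x
      = 1 / m * ∑ i, bitForm x₀ x (a i 0, a i 1) := by
  have h : ∀ (r : ℝ) (A : Matrix (Fin n) (Fin n) ℂ), quadForm ((r : ℂ) • A) x = r * quadForm A x :=
    fun r A => by
      rw [quadForm, Matrix.smul_mulVec, dotProduct_smul, smul_eq_mul, Complex.re_ofReal_mul, quadForm]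
  have hsum : ∀ A : Fin m → Matrix (Fin n) (Fin n) ℂ, quadForm (∑ i, A i) x = ∑ i, quadForm (A i) x :=
    fun A => by
      simp only [quadForm, Matrix.sum_mulVec, dotProduct_sum, Complex.re_sum]
  have hsub : ∀ A B : Matrix (Fin n) (Fin n) ℂ, quadForm (A - B) x = quadForm A x - quadForm B x :=
    fun A B => by
      simp only [quadForm, Matrix.sub_mulVec, dotProduct_sub, Complex.sub_re]
  have hm : (1 / (m : ℂ)) = ((1 / m : ℝ) : ℂ) := by push_cast; rfl
  rw [empMatrix, hm, h, hsum]
  simp only [h, hsub, quadForm_outer, quantizer_clip hα, bitForm]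

lemma exists_phase_norm_sub_sq_le {x₀ x : EuclideanSpace ℂ (Fin n)} (hx₀ : ‖x₀‖ = 1)
    (hx : ‖x‖ = 1) {ε : ℝ} (h : 1 - ε / 2 ≤ intensity x x₀) :
    ∃ φ ∈ Set.Icc (0 : ℝ) (2 * Real.pi), ‖x - Complex.exp (Complex.I * φ) • x₀‖ ^ 2 ≤ ε := by
  set c : ℂ := inner ℂ x₀ x
  have hφ : ∃ φ ∈ Set.Icc (0 : ℝ) (2 * Real.pi), c = ‖c‖ * Complex.exp (Complex.I * φ) := by
    have hc := (Complex.norm_mul_exp_arg_mul_I c).symm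
    rw [mul_comm (c.arg : ℂ)] at hc
    rcases le_or_gt 0 c.arg with h0 | h0
    · exact ⟨c.arg, ⟨h0, by linarith [Complex.arg_le_pi c, Real.pi_pos]⟩, hc⟩
    · refine ⟨c.arg + 2 * Real.pi, ⟨by linarith [Complex.neg_pi_lt_arg c, Real.pi_pos],
        by linarith⟩, ?_⟩
      have h2 : Complex.I * ((c.arg + 2 * Real.pi : ℝ) : ℂ)
          = Complex.I * c.arg + 2 * Real.pi * Complex.I := by push_cast; ring
      rw [h2, Complex.exp_periodic]
      exact hc
  obtain ⟨φ, hφ, hc⟩ := hφ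
  refine ⟨φ, hφ, ?_⟩
  set u := Complex.exp (Complex.I * φ) with hu
  have hu1 : ‖u‖ = 1 := by rw [hu, mul_comm, Complex.norm_exp_ofReal_mul_I]
  have hcn : ‖c‖ ≤ 1 := by
    have := norm_inner_le_norm (𝕜 := ℂ) x₀ x
    rwa [hx₀, hx, one_mul] at this
  have hin : (inner ℂ x (u • x₀) : ℂ).re = ‖c‖ := by
    have h1 : (inner ℂ x (u • x₀) : ℂ) = u * (starRingEnd ℂ) c := by
      rw [inner_smul_right, inner_conj_symm]
    have h2 : u * (starRingEnd ℂ) u = 1 := by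
      rw [Complex.mul_conj, Complex.normSq_eq_norm_sq, hu1]
      simp
    have h3 : u * (starRingEnd ℂ) c = ‖c‖ := by
      conv_lhs => rw [hc]
      rw [map_mul, Complex.conj_ofReal, mul_left_comm, h2, mul_one]
    rw [h1, h3, Complex.ofReal_re]
  have hexp := norm_sub_sq (𝕜 := ℂ) x (u • x₀)
  rw [RCLike.re_eq_complex_re, hin, norm_smul, hu1, hx₀, hx] at hexp
  rw [intensity_eq_norm_inner_right] at h
  -- The squared distance is 2 - 2‖c‖, and ‖c‖ ≥ ‖c‖² since ‖c‖ ≤ 1.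
  change 1 - ε / 2 ≤ ‖c‖ ^ 2 at h
  rw [hexp]
  nlinarith [norm_nonneg c]

/-- The deviations at x and x₀ add up to 2·(16/7)·(7/64)Sε = Sε/2, which explains the constant 7/64.
-/
lemma one_sub_le_intensity_of_isOneBitPhaseSolution {α ε : ℝ} (hα : 0 < α) (hn : 0 < n)
    (hm : 0 < m) {x₀ x : EuclideanSpace ℂ (Fin n)} (hx₀ : ‖x₀‖ = 1)
    {a : Fin m → Fin 2 → EuclideanSpace ℂ (Fin n)}
    (ha : (fun i => (a i 0, a i 1)) ∉ gridDeviation x₀ m (7 / 64 * gaussianSNR * ε))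
    (hx : IsOneBitPhaseSolution (empMatrix (clip α) x₀ a) x) :
    1 - ε / 2 ≤ intensity x x₀ := by
  have hm' : (0 : ℝ) < m := by exact_mod_cast hm
  have h := hx.2 x₀ hx₀
  rw [quadForm_empMatrix hα, quadForm_empMatrix hα] at h
  have h := le_of_mul_le_mul_left h (by positivity)
  have h1 := abs_le.1 (abs_sum_bitForm_sub_le_of_notMem hn ha hx₀)
  have h2 := abs_le.1 (abs_sum_bitForm_sub_le_of_notMem hn ha hx.1)
  have h3 : intensity x₀ x₀ = 1 := by
    rw [intensity, inner_self_eq_norm_sq_to_K, hx₀]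
    simp
  rw [h3] at h1
  refine le_of_mul_le_mul_left ?_ (mul_pos hm' gaussianSNR_pos)
  linarith [h1.1, h2.2]

end Deterministic

/-! ### The joint law of the sensing pairs -/

section JointLaw

lemma map_pairs_eq_pi {Ω E : Type*} [MeasurableSpace Ω] [MeasurableSpace E] {P : Measure Ω}
    {μ : Measure E} [IsProbabilityMeasure μ] {m : ℕ} {a : Fin m → Fin 2 → Ω → E}
    (ha : ∀ i j, HasLaw (a i j) μ P)
    (hind : iIndepFun (fun p : Fin m × Fin 2 => a p.1 p.2) P) :
    P.map (fun ω i => (a i 0 ω, a i 1 ω)) = Measure.pi fun _ : Fin m => μ.prod μ := by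
  have hP := hind.isProbabilityMeasure
  have hae : ∀ p : Fin m × Fin 2, AEMeasurable (a p.1 p.2) P := fun p => (ha p.1 p.2).aemeasurable
  have h1 : P.map (fun ω (p : Fin m × Fin 2) => a p.1 p.2 ω) = Measure.pi fun _ => μ := by
    rw [(iIndepFun_iff_map_fun_eq_pi_map hae).1 hind]
    congr 1
    funext p
    exact (ha p.1 p.2).map_eq
  have h2 : (Measure.pi fun _ : Fin m × Fin 2 => μ).map (MeasurableEquiv.curry (Fin m) (Fin 2) E)
      = Measure.pi fun _ => Measure.pi fun _ => μ := by
    simpa only [Measure.infinitePi_eq_pi] using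
      Measure.infinitePi_map_curry (fun (_ : Fin m) (_ : Fin 2) => μ)
  have h3 : MeasurePreserving (fun (v : Fin m → Fin 2 → E) i => (v i 0, v i 1))
      (Measure.pi fun _ => Measure.pi fun _ => μ) (Measure.pi fun _ => μ.prod μ) :=
    measurePreserving_pi _ _ fun _ => measurePreserving_finTwoArrow μ
  have hpi : AEMeasurable (fun ω (p : Fin m × Fin 2) => a p.1 p.2 ω) P := aemeasurable_pi_lambda _ hae
  rw [← h3.map_eq, ← h2, ← h1, AEMeasurable.map_map_of_aemeasurable
    (MeasurableEquiv.measurable _).aemeasurable hpi, AEMeasurable.map_map_of_aemeasurable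
    h3.measurable.aemeasurable ((MeasurableEquiv.measurable _).comp_aemeasurable hpi)]
  rfl

end JointLaw

/-! ### The failure probability and the sample size -/

section Probability

/-- Since 16n + 1 ≤ n⁶ for n ≥ 2, the grid costs exp(12 n log n); the 14 in C leaves exp(-2n log n)
≤ n⁻². -/
lemma pow_mul_exp_le {n m : ℕ} (hn : 2 ≤ n) {κ ε C l : ℝ} (hε : 0 < ε) (hl : 0 < l)
    (hC : C * κ = 14 * l) (hκ : 0 < κ) (hm : C / ε ^ 2 * (n * Real.log n / l) ≤ m) :
    (16 * n + 1 : ℝ) ^ (2 * n) * (2 * Real.exp (-(m * (κ * ε ^ 2)))) ≤ 2 / (n : ℝ) ^ 2 := by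
  have hn2 : (2 : ℝ) ≤ n := by exact_mod_cast hn
  have hn0 : (0 : ℝ) < n := by linarith
  have hlog : 0 ≤ Real.log n := Real.log_nonneg (by linarith)
  have h1 : (16 * n + 1 : ℝ) ≤ n ^ 6 := by
    have h32 : (2 : ℝ) ^ 5 ≤ n ^ 5 := pow_le_pow_left₀ (by norm_num) hn2 5
    have h6 : (n : ℝ) ^ 6 = n * n ^ 5 := by ring
    nlinarith
  have h2 : (16 * n + 1 : ℝ) ^ (2 * n) ≤ Real.exp (12 * (n * Real.log n)) := by
    refine (pow_le_pow_left₀ (by positivity) h1 _).trans_eq ?_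
    rw [← pow_mul, ← Real.exp_log (pow_pos hn0 _), Real.log_pow]
    congr 1
    push_cast
    ring
  have h3 : 14 * (n * Real.log n) ≤ m * (κ * ε ^ 2) := by
    have h := mul_le_mul_of_nonneg_right hm (mul_pos hκ (pow_pos hε 2)).le
    refine le_of_eq_of_le ?_ h
    have h4 : C / ε ^ 2 * (n * Real.log n / l) * (κ * ε ^ 2) = C * κ / l * (n * Real.log n) := by
      field_simp
    rw [h4, hC, mul_div_assoc, div_self hl.ne', mul_one]
  have h5 : Real.exp (-(m * (κ * ε ^ 2))) ≤ Real.exp (-(14 * (n * Real.log n))) :=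
    Real.exp_le_exp.2 (neg_le_neg h3)
  have h6 : 2 * Real.log n ≤ 2 * (n * Real.log n) := by nlinarith
  have h7 : ((n : ℝ) ^ 2)⁻¹ = Real.exp (-(2 * Real.log n)) := by
    rw [Real.exp_neg, ← Real.log_rpow hn0, Real.exp_log (by positivity)]
    norm_num
  calc (16 * n + 1 : ℝ) ^ (2 * n) * (2 * Real.exp (-(m * (κ * ε ^ 2))))
      ≤ Real.exp (12 * (n * Real.log n)) * (2 * Real.exp (-(14 * (n * Real.log n)))) := by gcongr
    _ = 2 * Real.exp (-(2 * (n * Real.log n))) := by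
        rw [mul_left_comm, ← Real.exp_add]
        ring_nf
    _ ≤ 2 * Real.exp (-(2 * Real.log n)) := by gcongr
    _ = 2 / (n : ℝ) ^ 2 := by rw [← h7, div_eq_mul_inv]

lemma exists_measurableSet_of_sampleSize {n m : ℕ} (hn : 2 ≤ n) {κ ε C l : ℝ}
    (hκ : κ = (7 / 64 * gaussianSNR) ^ 2 / (4 * varianceProxy)) (hε : 0 < ε) (hε1 : ε ≤ 1)
    (hl : 0 < l) (hC : C * κ = 14 * l) {x₀ : EuclideanSpace ℂ (Fin n)} (hx₀ : ‖x₀‖ = 1)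
    {Ω : Type*} [MeasurableSpace Ω] {P : Measure Ω} [IsProbabilityMeasure P]
    {a : Fin m → Fin 2 → Ω → EuclideanSpace ℂ (Fin n)}
    (ha : ∀ i j, HasLaw (a i j) (complexGaussianVec n) P)
    (hind : iIndepFun (fun p : Fin m × Fin 2 => a p.1 p.2) P)
    (hm : C / ε ^ 2 * (n * Real.log n / l) ≤ m) :
    ∃ G : Set Ω, MeasurableSet G ∧ 1 - 2 / (n : ℝ) ^ 2 ≤ P.real G ∧
      ∀ ω ∈ G, (fun i => (a i 0 ω, a i 1 ω)) ∉ gridDeviation x₀ m (7 / 64 * gaussianSNR * ε) := by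
  have hS := gaussianSNR_pos
  have hV := varianceProxy_pos
  set f : Ω → Fin m → EuclideanSpace ℂ (Fin n) × EuclideanSpace ℂ (Fin n) :=
    fun ω i => (a i 0 ω, a i 1 ω)
  have hf : AEMeasurable f P := aemeasurable_pi_lambda _ fun i =>
    (ha i 0).aemeasurable.prodMk (ha i 1).aemeasurable
  set B := gridDeviation x₀ m (7 / 64 * gaussianSNR * ε)
  have hB : P.real (f ⁻¹' B) ≤ 2 / (n : ℝ) ^ 2 := by
    have h := measureReal_gridDeviation_le hx₀ (δ := 7 / 64 * gaussianSNR * ε) (by positivity)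
      (by nlinarith) m
    rw [← map_pairs_eq_pi ha hind, measureReal_def, Measure.map_apply_of_aemeasurable hf
      (measurableSet_gridDeviation x₀ m _), ← measureReal_def] at h
    refine h.trans ?_
    have h2 := pow_mul_exp_le hn hε hl hC (by rw [hκ]; positivity) hm
    have h3 : (m : ℝ) * (7 / 64 * gaussianSNR * ε) ^ 2 / (4 * varianceProxy) = m * (κ * ε ^ 2) := by
      rw [hκ]; ring
    rwa [h3]
  -- The samples are only a.e. measurable, so the bad event is replaced by a measurable hull of the
  -- same measure.
  refine ⟨(toMeasurable P (f ⁻¹' B))ᶜ, (measurableSet_toMeasurable _ _).compl, ?_, fun ω hω hb =>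
    hω (subset_toMeasurable P (f ⁻¹' B) hb)⟩
  rw [probReal_compl_eq_one_sub (measurableSet_toMeasurable _ _), measureReal_def,
    measure_toMeasurable, ← measureReal_def]
  linarith

end Probability

end OneBit

end

theorem mainTheorem4 :
    (∃ C K : ℝ, 0 < C ∧ 0 < K ∧
      ∀ (n m : ℕ) (α ε : ℝ) (x₀ : EuclideanSpace ℂ (Fin n))
        (Ω : Type*) [MeasurableSpace Ω] (P : Measure Ω) [IsProbabilityMeasure P]
        (a : Fin m → Fin 2 → Ω → EuclideanSpace ℂ (Fin n)),
        ‖x₀‖ = 1 → 0 < α → 0 < ε → ε ≤ 1 →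
        (∀ i j, HasLaw (a i j) (OneBit.complexGaussianVec n) P) →
        iIndepFun (fun p : Fin m × Fin 2 => a p.1 p.2) P →
        C / ε ^ 2 * (n * Real.log n / OneBit.clipSNR α) ≤ m →
        ∃ G : Set Ω, MeasurableSet G ∧ 1 - K / (n : ℝ) ^ 2 ≤ P.real G ∧
          ∀ ω ∈ G, ∀ x : EuclideanSpace ℂ (Fin n),
            OneBit.IsOneBitPhaseSolution
              (OneBit.empMatrix (OneBit.clip α) x₀ (fun i j => a i j ω)) x →
            ∃ φ ∈ Set.Icc (0 : ℝ) (2 * Real.pi),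
              ‖x - Complex.exp (Complex.I * φ) • x₀‖ ^ 2 ≤ ε) ∧
    (∀ α : ℝ, 0 < α →
      Integrable (OneBit.clipIntegrand α) OneBit.expPair ∧ 0 < OneBit.clipSNR α) ∧
    AntitoneOn OneBit.clipSNR (Set.Ioi 0) := by
  open OneBit in
  have hS := gaussianSNR_pos
  have hV := varianceProxy_pos
  have hconst : ∀ α β, clipSNR α = clipSNR β := fun α β => by rw [clipSNR_eq, clipSNR_eq]
  set κ := (7 / 64 * gaussianSNR) ^ 2 / (4 * varianceProxy) with hκ
  have hκ0 : 0 < κ := by positivity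
  -- This C makes C / `clipSNR α` equal to 14 / κ for every α.
  refine ⟨⟨14 * clipSNR 1 / κ, 2, div_pos (mul_pos (by norm_num) (clipSNR_pos 1)) hκ0, two_pos, ?_⟩,
    fun α _ => ⟨integrable_clipIntegrand α, clipSNR_pos α⟩, fun α _ β _ _ => (hconst β α).le⟩
  intro n m α ε x₀ Ω _ P _ a hx₀ hα hε hε1 ha hind hm
  rcases Nat.lt_or_ge n 2 with hn | hn
  -- There is no unit vector for n = 0, and for n = 1 the required probability 1 - 2 is negative.
  · refine ⟨∅, MeasurableSet.empty, ?_, by simp⟩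
    interval_cases n
    · have : x₀ = 0 := Subsingleton.elim _ _
      simp [this] at hx₀
    · norm_num
  · obtain ⟨G, hG, hGP, hGB⟩ := exists_measurableSet_of_sampleSize hn hκ hε hε1 (clipSNR_pos α)
      (by rw [hconst α 1, div_mul_cancel₀ _ hκ0.ne']) hx₀ ha hind hm
    have hm0 : 0 < m := by
      have hn2 : (1 : ℝ) < n := by exact_mod_cast hn
      have hpos : 0 < 14 * clipSNR 1 / κ / ε ^ 2 * (n * Real.log n / clipSNR α) := by
        have h1 := clipSNR_pos 1
        have h2 := clipSNR_pos α
        have h3 := Real.log_pos hn2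
        positivity
      exact_mod_cast hpos.trans_le hm
    exact ⟨G, hG, hGP, fun ω hω x hx => exists_phase_norm_sub_sq_le hx₀ hx.1
      (one_sub_le_intensity_of_isOneBitPhaseSolution hα (by omega) hm0 hx₀ (hGB ω hω) hx)⟩
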